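/- Let $n\ge 2$ be an even integer and $s\ge n$ a real number. Let $Q:\mathbb{R}^n\to\mathbb{R}$ be a smooth function satisfying the $s$-cone condition, that is: $Q \in L^\infty_{loc}(\mathbb{R}^n)$; there is a constant $C$ with $|Q(x)|\le C(|x|+1)^s$ for all $x\in\mathbb{R}^n$; and there are $0<r_0<1$, $c_1>0$ and a sequence $(x_i)\subset\mathbb{R}^n$ with $|x_i|\ge 1$ and $|x_i|\to\infty$ such that $|Q(x)|/|x|^s\ge c_1$ for every $i$ and every $x\in B_{r_0|x_i|}(x_i)$. Suppose moreover that $x\cdot\nabla Q(x)\le 0$ for all $x\in\mathbb{R}^n$. Then there is no smooth function $u:\mathbb{R}^n\to\mathbb{R}$ with $Qe^{nu}\in L^1(\mathbb{R}^n)$ that is a normal solution with $Q$-curvature $Q$, i.e. such that, for some constant $C\in\mathbb{R}$, $$u(x)=\frac{2}{(n-1)!\,|\mathbb{S}^n|}\int_{\mathbb{R}^n}\log\frac{|y|}{|x-y|}\,Q(y)e^{nu(y)}\,dy+C\qquad\text{for all }x\in\mathbb{R}^n,$$ where $|\mathbb{S}^n|$ is the volume of the standard unit $n$-sphere. -/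

import Mathlib

open MeasureTheory Filter Topology
open scoped ContDiff Nat ENNReal

/-- The volume `|𝕊ⁿ|` of the standard unit sphere of `ℝⁿ⁺¹`, for its surface measure. -/
noncomputable def sphereVolume (n : ℕ) : ℝ :=
  (volume : Measure (EuclideanSpace ℝ (Fin (n + 1)))).toSphere.real Set.univ

/-- The function `u` is a normal solution with Q-curvature `Q`: for some constant `C`,
`u(x) = 2 / ((n-1)! |𝕊ⁿ|) ∫ log (|y| / |x - y|) Q(y) e^{n u(y)} dy + C` for all `x`.
Used for smooth `Q`, `u` with `Q e^{nu}` integrable, in which case the integral converges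
absolutely for every `x`. -/
def IsNormalSolution (n : ℕ) (Q u : EuclideanSpace ℝ (Fin n) → ℝ) : Prop :=
  ∃ C : ℝ, ∀ x : EuclideanSpace ℝ (Fin n),
    u x = 2 / (((n - 1)! : ℕ) * sphereVolume n) *
      (∫ y, Real.log (‖y‖ / ‖x - y‖) * (Q y * Real.exp (n * u y))) + C

/-- The `s`-cone condition for a function `ψ` in `L^∞_loc(ℝⁿ)`. -/
structure SatisfiesCone {n : ℕ} (s : ℝ) (ψ : EuclideanSpace ℝ (Fin n) → ℝ) : Prop where
  memLp_loc : ∀ K : Set (EuclideanSpace ℝ (Fin n)), IsCompact K →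
    MemLp ψ ∞ (volume.restrict K)
  growth : ∃ C : ℝ, ∀ x, |ψ x| ≤ C * (‖x‖ + 1) ^ s
  cone : ∃ r₀ : ℝ, 0 < r₀ ∧ r₀ < 1 ∧
    ∃ p : ℕ → EuclideanSpace ℝ (Fin n),
      (∀ i, 1 ≤ ‖p i‖) ∧ Tendsto (fun i => ‖p i‖) atTop atTop ∧
      ∃ c₁ : ℝ, 0 < c₁ ∧ ∀ i, ∀ x ∈ Metric.ball (p i) (r₀ * ‖p i‖), c₁ ≤ |ψ x| / ‖x‖ ^ s

/-!
Put `F = ∫ Q e^{au}` and let `d` be the dimension. On average over the balls `B(p, r|p|)` the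
representation gives `u(x) ≈ -bF log |x|`, so by Jensen's inequality the mass of `Q e^{au}` on a
ball of the cone condition is at least of order `|p|^{s + d - abF}`; it stays bounded, whence
`s + d ≤ abF`.

Differentiating the logarithmic kernel and symmetrising in `x` and `y`, the double integral of
`x · ∇u` against `Q e^{au}` has kernel `-(b/2) ⟨x - y, x - y⟩ / |x - y|² = -b/2`. Hence the Pohozaev
identity reads `∫ (x · ∇Q) e^{au} = (ab/2) F² - dF` up to cutoffs, and `x · ∇Q ≤ 0` gives
`abF ≤ 2d`. As `s ≥ d`, both bounds are equalities, so `x · ∇Q` vanishes identically and `Q` is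
constant, which contradicts its growth on the cones.
-/

section Preliminaries

lemma integrableOn_ball_of_locallyIntegrable {X : Type*} [PseudoMetricSpace X] [ProperSpace X]
    [MeasurableSpace X] {μ : Measure X} {g : X → ℝ} (hg : LocallyIntegrable g μ) (p : X) (ρ : ℝ) :
    IntegrableOn g (Metric.ball p ρ) μ :=
  (hg.integrableOn_isCompact (isCompact_closedBall p ρ)).mono_set Metric.ball_subset_closedBall

lemma measureReal_ball_pos {X : Type*} [PseudoMetricSpace X] [ProperSpace X] [MeasurableSpace X]
    (μ : Measure X) [μ.IsOpenPosMeasure] [IsFiniteMeasureOnCompacts μ] (p : X) {ρ : ℝ}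
    (hρ : 0 < ρ) : 0 < μ.real (Metric.ball p ρ) :=
  ENNReal.toReal_pos (Metric.measure_ball_pos μ p hρ).ne' measure_ball_lt_top.ne

lemma integrableOn_prod_univ_comp_snd {X Y : Type*} [MeasureSpace X] [MeasureSpace Y]
    [SFinite (volume : Measure X)] [SFinite (volume : Measure Y)] {f : Y → ℝ}
    (hf : Integrable f) {s : Set X} (hs : volume s ≠ ⊤) :
    IntegrableOn (fun q : X × Y => f q.2) (s ×ˢ Set.univ) := by
  have : IsFiniteMeasure (volume.restrict s) := isFiniteMeasure_restrict.2 hs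
  rw [IntegrableOn, Measure.volume_eq_prod, ← Measure.prod_restrict, Measure.restrict_univ]
  exact hf.comp_snd _

lemma abs_average_add_le_of_abs_add_le {α : Type*} {mα : MeasurableSpace α} {μ : Measure α}
    [IsFiniteMeasure μ] [NeZero μ] {g k : α → ℝ} (hg : AEStronglyMeasurable g μ)
    (hk : Integrable k μ) {c D : ℝ} (h : ∀ᵐ x ∂μ, |g x + c| ≤ k x + D) :
    |(⨍ x, g x ∂μ) + c| ≤ (⨍ x, k x ∂μ) + D := by
  set ν := (μ Set.univ)⁻¹ • μ
  have hν : IsProbabilityMeasure ν := isProbabilityMeasureSMul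
  have hkD : Integrable (fun x => k x + D) μ := hk.add (integrable_const D)
  have hgc : Integrable (fun x => g x + c) μ := hkD.mono' (hg.add_const c) h
  have hg_int : Integrable g μ := by
    simpa only [Pi.sub_def, add_sub_cancel_right] using hgc.sub (integrable_const c)
  calc |(⨍ x, g x ∂μ) + c| = |∫ x, (g x + c) ∂ν| := by
        rw [integral_add hg_int.to_average (integrable_const c), integral_const, probReal_univ,
          one_smul]
        rfl
    _ ≤ ∫ x, (k x + D) ∂ν :=
        norm_integral_le_of_norm_le (f := fun x => g x + c) hkD.to_average
          (Measure.ae_smul_measure h _)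
    _ = (⨍ x, k x ∂μ) + D := by
        rw [integral_add hk.to_average (integrable_const D), integral_const, probReal_univ,
          one_smul]
        rfl

end Preliminaries

section InverseNorm

variable {E : Type*} [NormedAddCommGroup E] [NormedSpace ℝ E] [FiniteDimensional ℝ E]
  [MeasureSpace E] [BorelSpace E] [(volume : Measure E).IsAddHaarMeasure]

lemma exists_integrable_inv_norm_le (hE : 2 ≤ Module.finrank ℝ E) :
    ∃ k : E → ℝ, Integrable k ∧ (∀ z, 0 ≤ k z) ∧ ∀ z, ‖z‖⁻¹ ≤ 1 + k z := by
  refine ⟨(Metric.ball 0 1).indicator fun z => ‖z‖⁻¹, ?_,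
    Set.indicator_nonneg fun z _ => by positivity, fun z => ?_⟩
  · rw [integrable_indicator_iff measurableSet_ball]
    refine integrableOn_ball_of_norm_le_rpow (C := 1) (α := 1) (by lia)
      (by exact_mod_cast hE) (ae_of_all _ fun z => ?_) (by fun_prop)
    simp [Real.rpow_neg_one]
  · by_cases hz : z ∈ Metric.ball (0 : E) 1
    · simp [Set.indicator_of_mem hz]
    · rw [Set.indicator_of_notMem hz, add_zero]
      exact inv_le_one_of_one_le₀ (by simpa using hz)

lemma locallyIntegrable_inv_norm_sub (hE : 2 ≤ Module.finrank ℝ E) (y : E) :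
    LocallyIntegrable fun x : E => ‖x - y‖⁻¹ := by
  obtain ⟨k, hk, -, hle⟩ := exists_integrable_inv_norm_le hE
  refine ((locallyIntegrable_const (1 : ℝ)).add
    (hk.comp_sub_right y).locallyIntegrable).mono (by fun_prop) (ae_of_all _ fun x => ?_)
  rw [norm_inv, norm_norm]
  exact (hle _).trans (le_abs_self _)

lemma integrable_mul_inv_norm (hE : 2 ≤ Module.finrank ℝ E) {f : E → ℝ} (hf : Continuous f)
    (hfi : Integrable f) : Integrable fun y => f y * ‖y‖⁻¹ := by
  have near : IntegrableOn (fun y => f y * ‖y‖⁻¹) (Metric.closedBall 0 1) := by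
    have h := (locallyIntegrable_inv_norm_sub hE 0).integrableOn_isCompact
      (isCompact_closedBall (0 : E) 1)
    simp only [sub_zero] at h
    exact h.continuousOn_mul hf.continuousOn (isCompact_closedBall 0 1)
  have far : IntegrableOn (fun y => f y * ‖y‖⁻¹) (Metric.closedBall 0 1)ᶜ := by
    refine hfi.norm.integrableOn.mono' (by fun_prop)
      (ae_restrict_of_forall_mem measurableSet_closedBall.compl fun y hy => ?_)
    have hy1 : 1 ≤ ‖y‖ := by
      rw [Set.mem_compl_iff, mem_closedBall_zero_iff, not_le] at hy
      exact hy.le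
    rw [norm_mul, norm_inv, norm_norm]
    exact mul_le_of_le_one_right (norm_nonneg _) (inv_le_one_of_one_le₀ hy1)
  rw [← integrableOn_univ, ← Set.union_compl_self (Metric.closedBall (0 : E) 1)]
  exact near.union far

lemma integrableOn_prod_inv_norm_sub_mul (hE : 2 ≤ Module.finrank ℝ E) {f : E → ℝ}
    (hf : Integrable f) {s : Set E} (hs : volume s ≠ ⊤) :
    IntegrableOn (fun q : E × E => ‖q.1 - q.2‖⁻¹ * f q.2) (s ×ˢ Set.univ) := by
  obtain ⟨k, hk, -, hle⟩ := exists_integrable_inv_norm_le hE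
  have hconv : Integrable fun q : E × E => ‖f q.2‖ * k (q.1 - q.2) :=
    hf.norm.convolution_integrand (ContinuousLinearMap.mul ℝ ℝ) hk
  refine ((integrableOn_prod_univ_comp_snd hf hs).norm.add hconv.integrableOn).mono'
    ?_ (ae_of_all _ fun q => ?_)
  · exact ((by fun_prop : Measurable fun q : E × E => ‖q.1 - q.2‖⁻¹).aestronglyMeasurable.mul
      hf.aestronglyMeasurable.comp_snd).restrict
  · simp only [norm_mul, norm_inv, norm_norm, Pi.add_apply]
    linarith [mul_le_mul_of_nonneg_right (hle (q.1 - q.2)) (norm_nonneg (f q.2))]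

lemma exists_setAverage_inv_norm_sub_le (hE : 2 ≤ Module.finrank ℝ E) :
    ∃ A : ℝ, ∀ (p y : E) (r : ℝ), 0 < r → ⨍ x in Metric.ball p r, ‖x - y‖⁻¹ ≤ A / r := by
  have : Nontrivial E := Module.nontrivial_of_finrank_pos (R := ℝ) (by lia)
  obtain ⟨k, hk, hk0, hle⟩ := exists_integrable_inv_norm_le hE
  refine ⟨1 + (volume.real (Metric.ball (0 : E) 1))⁻¹ * ∫ z, k z, fun p y r hr => ?_⟩
  set B := Metric.ball p r
  set V := volume.real (Metric.ball (0 : E) 1)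
  have hV : 0 < V := measureReal_ball_pos _ _ one_pos
  have hB : volume.real B = r ^ Module.finrank ℝ E * V := by
    rw [← Measure.addHaar_real_closedBall_eq_addHaar_real_ball,
      Measure.addHaar_real_closedBall _ _ hr.le]
  have hkr : Integrable fun x => k (r⁻¹ • (x - y)) :=
    (hk.comp_smul (inv_ne_zero hr.ne')).comp_sub_right y
  have hkr_int : ∫ x, k (r⁻¹ • (x - y)) = r ^ Module.finrank ℝ E * ∫ z, k z := by
    rw [integral_sub_right_eq_self fun x => k (r⁻¹ • x),
      Measure.integral_comp_inv_smul_of_nonneg _ _ hr.le, smul_eq_mul]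
  have hscale (z : E) : ‖z‖⁻¹ ≤ r⁻¹ * (1 + k (r⁻¹ • z)) := by
    have h := mul_le_mul_of_nonneg_left (hle (r⁻¹ • z)) (inv_nonneg.2 hr.le)
    rwa [norm_smul, norm_inv, Real.norm_of_nonneg hr.le, mul_inv, inv_inv,
      inv_mul_cancel_left₀ hr.ne'] at h
  have hone : IntegrableOn (fun _ => (1 : ℝ)) B := integrableOn_const measure_ball_lt_top.ne
  have hset : ∫ x in B, ‖x - y‖⁻¹ ≤ r⁻¹ * (volume.real B + r ^ Module.finrank ℝ E * ∫ z, k z) :=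
    calc ∫ x in B, ‖x - y‖⁻¹ ≤ ∫ x in B, r⁻¹ * (1 + k (r⁻¹ • (x - y))) :=
          integral_mono_of_nonneg (ae_of_all _ fun x => by positivity)
            ((hone.add hkr.integrableOn).const_mul _) (ae_of_all _ fun x => hscale _)
      _ = r⁻¹ * (volume.real B + ∫ x in B, k (r⁻¹ • (x - y))) := by
          rw [integral_const_mul, integral_add hone hkr.integrableOn, setIntegral_const,
            smul_eq_mul, mul_one]
      _ ≤ _ := by
          rw [← hkr_int]
          gcongr r⁻¹ * (volume.real B + ?_)
          exact setIntegral_le_integral hkr (ae_of_all _ fun x => hk0 _)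
  rw [setAverage_eq, smul_eq_mul, inv_mul_le_iff₀ (hB ▸ by positivity)]
  refine hset.trans_eq ?_
  rw [hB]
  field_simp

end InverseNorm

section LogKernel

open Real (log posLog)

lemma abs_log_norm_div_add_log_le {E : Type*} [NormedAddCommGroup E] {x y : E} (hy : y ≠ 0)
    (hxy : x ≠ y) {P : ℝ} (hP : 1 ≤ P) (hx : ‖x‖ ≤ 2 * P) :
    |log (‖y‖ / ‖x - y‖) + log P| ≤
      2 * P * ‖x - y‖⁻¹ + 2 * ‖y‖⁻¹ + min (log P) (posLog ‖y‖) := by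
  have hP0 : 0 < P := by linarith
  have hy0 : 0 < ‖y‖ := norm_pos_iff.2 hy
  have hxy0 : 0 < ‖x - y‖ := norm_pos_iff.2 (sub_ne_zero.2 hxy)
  have hlogP : 0 ≤ log P := Real.log_nonneg hP
  have hmin : 0 ≤ min (log P) (posLog ‖y‖) := le_min hlogP Real.posLog_nonneg
  have hxy_inv : 0 < 2 * P * ‖x - y‖⁻¹ := by positivity
  have upper_P : log (‖y‖ / ‖x - y‖) ≤ 2 * P * ‖x - y‖⁻¹ := by
    refine (Real.log_le_sub_one_of_pos (by positivity)).trans ?_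
    rw [sub_le_iff_le_add, div_le_iff₀ hxy0, add_mul, inv_mul_cancel_right₀ hxy0.ne', one_mul]
    linarith [norm_le_norm_add_norm_sub x y]
  have upper_y : log (‖y‖ / ‖x - y‖) + log P ≤ 2 * P * ‖x - y‖⁻¹ + posLog ‖y‖ := by
    have h := Real.log_le_self (show 0 ≤ P / ‖x - y‖ by positivity)
    rw [Real.log_div hP0.ne' hxy0.ne', div_eq_mul_inv] at h
    rw [Real.log_div hy0.ne' hxy0.ne']
    have hle : log ‖y‖ ≤ posLog ‖y‖ := le_max_right _ _
    linarith
  have lower : -(log (‖y‖ / ‖x - y‖) + log P) ≤ 2 * ‖y‖⁻¹ := by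
    rw [← Real.log_mul (by positivity) hP0.ne', ← Real.log_inv]
    refine (Real.log_le_sub_one_of_pos (by positivity)).trans ?_
    rw [mul_inv, inv_div, sub_le_iff_le_add, ← div_eq_mul_inv, div_div, div_le_iff₀ (by positivity)]
    have hexp : (2 * ‖y‖⁻¹ + 1) * (‖y‖ * P) = 2 * P + ‖y‖ * P := by field_simp
    rw [hexp]
    linarith [norm_sub_le x y, le_mul_of_one_le_right hy0.le hP]
  rw [abs_le]
  refine ⟨by linarith, ?_⟩
  have hy_inv : 0 < 2 * ‖y‖⁻¹ := by positivity
  rcases min_choice (log P) (posLog ‖y‖) with h | h <;> rw [h] <;> linarith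

variable {E : Type*} [NormedAddCommGroup E] [NormedSpace ℝ E] [FiniteDimensional ℝ E]
  [MeasureSpace E] [BorelSpace E] [(volume : Measure E).IsAddHaarMeasure]

lemma integrableOn_prod_log_norm_div_mul (hE : 2 ≤ Module.finrank ℝ E) {f : E → ℝ}
    (hf : Integrable f) (hf' : Integrable fun y => f y * ‖y‖⁻¹) {s : Set E}
    (hs : Bornology.IsBounded s) :
    IntegrableOn (fun q : E × E => log (‖q.2‖ / ‖q.1 - q.2‖) * f q.2) (s ×ˢ Set.univ) := by
  obtain ⟨P, hP, hsP⟩ := hs.subset_closedBall_lt 1 0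
  have hP0 : 0 ≤ log P := Real.log_nonneg hP.le
  suffices h : IntegrableOn (fun q : E × E => log (‖q.2‖ / ‖q.1 - q.2‖) * f q.2)
      (Metric.closedBall 0 P ×ˢ Set.univ) from h.mono_set (Set.prod_mono hsP le_rfl)
  have hfin : volume (Metric.closedBall (0 : E) P) ≠ ⊤ := measure_closedBall_lt_top.ne
  refine ((((integrableOn_prod_inv_norm_sub_mul hE hf hfin).norm.const_mul (2 * P)).add
    ((integrableOn_prod_univ_comp_snd hf' hfin).norm.const_mul 2)).add
    ((integrableOn_prod_univ_comp_snd hf hfin).norm.const_mul (2 * log P))).mono' ?_ ?_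
  · exact ((by fun_prop : Measurable fun q : E × E =>
      log (‖q.2‖ / ‖q.1 - q.2‖)).aestronglyMeasurable.mul
        hf.aestronglyMeasurable.comp_snd).restrict
  · refine ae_restrict_of_forall_mem (measurableSet_closedBall.prod .univ) fun q hq => ?_
    have hkernel : ‖log (‖q.2‖ / ‖q.1 - q.2‖)‖ ≤
        2 * P * ‖q.1 - q.2‖⁻¹ + 2 * ‖q.2‖⁻¹ + 2 * log P := by
      rw [Real.norm_eq_abs]
      rcases eq_or_ne q.2 0 with h0 | h0
      · simp only [h0, norm_zero, zero_div, Real.log_zero, abs_zero]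
        positivity
      rcases eq_or_ne q.1 q.2 with h1 | h1
      · simp only [h1, sub_self, norm_zero, div_zero, Real.log_zero, abs_zero]
        positivity
      have h := abs_log_norm_div_add_log_le h0 h1 hP.le
        ((mem_closedBall_zero_iff.1 hq.1).trans (by linarith))
      rw [abs_le] at h ⊢
      constructor <;> linarith [h.1, h.2, min_le_left (log P) (posLog ‖q.2‖)]
    simp only [norm_mul, norm_inv, norm_norm, Pi.add_apply]
    calc _ ≤ _ := mul_le_mul_of_nonneg_right hkernel (norm_nonneg (f q.2))
      _ = _ := by ring

/-- The logarithmic potential of the density `f`, with the kernel normalised to vanish at `x = 0`.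
-/
noncomputable def logPotential (f : E → ℝ) (x : E) : ℝ :=
  ∫ y, log (‖y‖ / ‖x - y‖) * f y

lemma integrableOn_logPotential (hE : 2 ≤ Module.finrank ℝ E) {f : E → ℝ}
    (hf : Integrable f) (hf' : Integrable fun y => f y * ‖y‖⁻¹) {s : Set E}
    (hs : Bornology.IsBounded s) : IntegrableOn (logPotential f) s := by
  have h := integrableOn_prod_log_norm_div_mul hE hf hf' hs
  rw [IntegrableOn, Measure.volume_eq_prod, ← Measure.prod_restrict, Measure.restrict_univ] at h
  exact h.integral_prod_left

lemma setAverage_logPotential (hE : 2 ≤ Module.finrank ℝ E) {f : E → ℝ}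
    (hf : Integrable f) (hf' : Integrable fun y => f y * ‖y‖⁻¹) {s : Set E}
    (hs : Bornology.IsBounded s) :
    ⨍ x in s, logPotential f x = ∫ y, (⨍ x in s, log (‖y‖ / ‖x - y‖)) * f y := by
  have h := integrableOn_prod_log_norm_div_mul hE hf hf' hs
  rw [IntegrableOn, Measure.volume_eq_prod, ← Measure.prod_restrict, Measure.restrict_univ] at h
  simp only [setAverage_eq, smul_eq_mul, logPotential]
  rw [integral_integral_swap (f := fun x y => log (‖y‖ / ‖x - y‖) * f y) h, ← integral_const_mul]
  simp only [integral_mul_const, mul_assoc]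

lemma exists_abs_setAverage_log_norm_div_add_log_le (hE : 2 ≤ Module.finrank ℝ E) {r : ℝ}
    (hr0 : 0 < r) (hr1 : r ≤ 1) :
    ∃ A : ℝ, ∀ p y : E, 1 ≤ ‖p‖ → y ≠ 0 →
      |(⨍ x in Metric.ball p (r * ‖p‖), log (‖y‖ / ‖x - y‖)) + log ‖p‖| ≤
        A + 2 * ‖y‖⁻¹ + min (log ‖p‖) (posLog ‖y‖) := by
  have : Nontrivial E := Module.nontrivial_of_finrank_pos (R := ℝ) (by lia)
  obtain ⟨A, hA⟩ := exists_setAverage_inv_norm_sub_le hE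
  refine ⟨2 * A / r, fun p y hp hy => ?_⟩
  have hρ : 0 < r * ‖p‖ := by positivity
  set B := Metric.ball p (r * ‖p‖)
  have : NeZero (volume.restrict B) :=
    ⟨Measure.restrict_eq_zero.not.2 (Metric.measure_ball_pos _ _ hρ).ne'⟩
  have hker : IntegrableOn (fun x => ‖x - y‖⁻¹) B :=
    integrableOn_ball_of_locallyIntegrable (locallyIntegrable_inv_norm_sub hE y) _ _
  have : IsFiniteMeasure (volume.restrict B) := isFiniteMeasure_restrict.2 measure_ball_lt_top.ne
  set D := 2 * ‖y‖⁻¹ + min (log ‖p‖) (posLog ‖y‖)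
  have hbound : ∀ᵐ x ∂volume.restrict B,
      |log (‖y‖ / ‖x - y‖) + log ‖p‖| ≤ 2 * ‖p‖ * ‖x - y‖⁻¹ + D := by
    filter_upwards [ae_restrict_of_ae (Measure.ae_ne volume y),
      ae_restrict_mem measurableSet_ball] with x hxy hx
    have hxp : ‖x‖ ≤ 2 * ‖p‖ := by
      have h := norm_lt_of_mem_ball hx
      nlinarith
    exact (abs_log_norm_div_add_log_le hy hxy hp hxp).trans_eq (add_assoc _ _ _)
  have hmeas : Measurable fun x : E => log (‖y‖ / ‖x - y‖) := by fun_prop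
  calc _ ≤ (⨍ x in B, 2 * ‖p‖ * ‖x - y‖⁻¹) + D :=
        abs_average_add_le_of_abs_add_le hmeas.aestronglyMeasurable (hker.const_mul _) hbound
    _ = 2 * ‖p‖ * (⨍ x in B, ‖x - y‖⁻¹) + D := by rw [average, integral_const_mul, average]
    _ ≤ 2 * ‖p‖ * (A / (r * ‖p‖)) + D := by gcongr; exact hA p y _ hρ
    _ = 2 * A / r + 2 * ‖y‖⁻¹ + min (log ‖p‖) (posLog ‖y‖) := by
        rw [add_assoc]
        congr 1
        field_simp

lemma tendsto_setAverage_log_norm_div_div_log (hE : 2 ≤ Module.finrank ℝ E) {r : ℝ}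
    (hr0 : 0 < r) (hr1 : r ≤ 1) {p : ℕ → E} (hp : Tendsto (fun i => ‖p i‖) atTop atTop) {y : E}
    (hy : y ≠ 0) :
    Tendsto (fun i => (⨍ x in Metric.ball (p i) (r * ‖p i‖), log (‖y‖ / ‖x - y‖)) / log ‖p i‖)
      atTop (𝓝 (-1)) := by
  obtain ⟨A, hA⟩ := exists_abs_setAverage_log_norm_div_add_log_le hE hr0 hr1
  have hlog : Tendsto (fun i => log ‖p i‖) atTop atTop := Real.tendsto_log_atTop.comp hp
  rw [tendsto_iff_norm_sub_tendsto_zero]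
  refine squeeze_zero' (Eventually.of_forall fun _ => norm_nonneg _) ?_
    (hlog.const_div_atTop (A + 2 * ‖y‖⁻¹ + posLog ‖y‖))
  filter_upwards [hp.eventually_ge_atTop 1, hlog.eventually_gt_atTop 0] with i hi hlogi
  rw [← neg_div_self hlogi.ne', ← sub_div, sub_neg_eq_add, norm_div, Real.norm_eq_abs,
    Real.norm_of_nonneg hlogi.le]
  gcongr
  exact (hA (p i) y hi hy).trans (by gcongr; exact min_le_right _ _)

lemma tendsto_setAverage_logPotential_div_log (hE : 2 ≤ Module.finrank ℝ E) {f : E → ℝ}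
    (hf : Integrable f) (hf' : Integrable fun y => f y * ‖y‖⁻¹) {r : ℝ} (hr0 : 0 < r)
    (hr1 : r ≤ 1) {p : ℕ → E} (hp : Tendsto (fun i => ‖p i‖) atTop atTop) :
    Tendsto (fun i => (⨍ x in Metric.ball (p i) (r * ‖p i‖), logPotential f x) / log ‖p i‖)
      atTop (𝓝 (-∫ y, f y)) := by
  have : Nontrivial E := Module.nontrivial_of_finrank_pos (R := ℝ) (by lia)
  obtain ⟨A, hA⟩ := exists_abs_setAverage_log_norm_div_add_log_le hE hr0 hr1
  have hlog : Tendsto (fun i => log ‖p i‖) atTop atTop := Real.tendsto_log_atTop.comp hp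
  set T : ℕ → E → ℝ := fun i y =>
    (⨍ x in Metric.ball (p i) (r * ‖p i‖), log (‖y‖ / ‖x - y‖)) / log ‖p i‖
  have hmean (i : ℕ) : (⨍ x in Metric.ball (p i) (r * ‖p i‖), logPotential f x) / log ‖p i‖ =
      ∫ y, T i y * f y := by
    rw [setAverage_logPotential hE hf hf' Metric.isBounded_ball, ← integral_div]
    simp only [T, div_mul_eq_mul_div]
  have hT_meas (i : ℕ) : AEStronglyMeasurable (T i) := by
    have h : StronglyMeasurable fun q : E × E => log (‖q.1‖ / ‖q.2 - q.1‖) :=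
      (by fun_prop : Measurable _).stronglyMeasurable
    exact (h.integral_prod_right.measurable.div_const _).aestronglyMeasurable
  have hne : ∀ᵐ y : E, y ≠ 0 := Measure.ae_ne volume 0
  simp only [hmean]
  rw [← neg_one_mul, ← integral_const_mul]
  refine tendsto_integral_filter_of_dominated_convergence
    (fun y => 3 * ‖f y‖ + 2 * ‖f y * ‖y‖⁻¹‖)
    (Eventually.of_forall fun i => (hT_meas i).mul hf.aestronglyMeasurable) ?_
    ((hf.norm.const_mul 3).add (hf'.norm.const_mul 2)) ?_
  · filter_upwards [hp.eventually_ge_atTop 1, hlog.eventually_ge_atTop 1,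
      hlog.eventually_ge_atTop A] with i hi hlogi hAi
    filter_upwards [hne] with y hy
    have hT : ‖T i y‖ ≤ 3 + 2 * ‖y‖⁻¹ := by
      have h := hA (p i) y hi hy
      have hy_inv : 0 ≤ ‖y‖⁻¹ := by positivity
      rw [norm_div, Real.norm_of_nonneg (show 0 ≤ log ‖p i‖ by linarith),
        div_le_iff₀ (by linarith), Real.norm_eq_abs, abs_le]
      rw [abs_le] at h
      constructor <;> nlinarith [min_le_left (log ‖p i‖) (posLog ‖y‖)]
    calc ‖T i y * f y‖ ≤ (3 + 2 * ‖y‖⁻¹) * ‖f y‖ := by rw [norm_mul]; gcongr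
      _ = 3 * ‖f y‖ + 2 * ‖f y * ‖y‖⁻¹‖ := by rw [norm_mul, norm_inv, norm_norm]; ring
  · filter_upwards [hne] with y hy
    exact (tendsto_setAverage_log_norm_div_div_log hE hr0 hr1 hp hy).mul_const (f y)

lemma tendsto_setAverage_div_log_of_eq_logPotential (hE : 2 ≤ Module.finrank ℝ E) {f : E → ℝ}
    (hf : Integrable f) (hf' : Integrable fun y => f y * ‖y‖⁻¹) {u : E → ℝ} {b C : ℝ}
    (hrep : ∀ x, u x = b * logPotential f x + C) {r : ℝ} (hr0 : 0 < r) (hr1 : r ≤ 1) {p : ℕ → E}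
    (hp : Tendsto (fun i => ‖p i‖) atTop atTop) :
    Tendsto (fun i => (⨍ x in Metric.ball (p i) (r * ‖p i‖), u x) / log ‖p i‖) atTop
      (𝓝 (-(b * ∫ y, f y))) := by
  have : Nontrivial E := Module.nontrivial_of_finrank_pos (R := ℝ) (by lia)
  have hlog : Tendsto (fun i => log ‖p i‖) atTop atTop := Real.tendsto_log_atTop.comp hp
  have hlim := ((tendsto_setAverage_logPotential_div_log hE hf hf' hr0 hr1 hp).const_mul b).add
    (hlog.const_div_atTop C)
  rw [add_zero, mul_neg] at hlim
  refine hlim.congr' ?_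
  filter_upwards [hp.eventually_gt_atTop 0] with i hi
  set B := Metric.ball (p i) (r * ‖p i‖)
  have hB : volume B ≠ 0 := (Metric.measure_ball_pos _ _ (by positivity)).ne'
  have hB_top : volume B ≠ ⊤ := measure_ball_lt_top.ne
  have havg : ⨍ x in B, u x = b * (⨍ x in B, logPotential f x) + C :=
    calc ⨍ x in B, u x = (⨍ x in B, b * logPotential f x) + ⨍ _ in B, C := by
          simp only [hrep, setAverage_eq, smul_eq_mul, ← mul_add]
          rw [integral_add ((integrableOn_logPotential hE hf hf' Metric.isBounded_ball).const_mul b)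
            (integrableOn_const hB_top)]
      _ = b * (⨍ x in B, logPotential f x) + C := by
          rw [setAverage_const hB hB_top, average, integral_const_mul, average]
  rw [havg, add_div, mul_div_assoc]

end LogKernel

section ConeGrowth

variable {E : Type*} [NormedAddCommGroup E]

/-- `|Q|` is bounded below by a multiple of `‖x‖ ^ s` on balls `B(p i, r ‖p i‖)` whose centres
escape to infinity: the lower bound in the `s`-cone condition, written without division. -/
def GrowsOnCones (s : ℝ) (Q : E → ℝ) : Prop :=
  ∃ r : ℝ, 0 < r ∧ r < 1 ∧ ∃ p : ℕ → E, Tendsto (fun i => ‖p i‖) atTop atTop ∧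
    ∃ c : ℝ, 0 < c ∧ ∀ i, ∀ x ∈ Metric.ball (p i) (r * ‖p i‖), c * ‖x‖ ^ s ≤ |Q x|

lemma SatisfiesCone.growsOnCones {n : ℕ} {s : ℝ} {Q : EuclideanSpace ℝ (Fin n) → ℝ}
    (h : SatisfiesCone s Q) : GrowsOnCones s Q := by
  obtain ⟨r, hr0, hr1, p, -, hp, c, hc, hle⟩ := h.cone
  exact ⟨r, hr0, hr1, p, hp, c, hc, fun i x hx =>
    mul_le_of_le_div₀ (abs_nonneg _) (by positivity) (hle i x hx)⟩

lemma GrowsOnCones.not_bounded {s : ℝ} {Q : E → ℝ} (hQ : GrowsOnCones s Q) (hs : 0 < s) :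
    ¬ ∃ M, ∀ x, |Q x| ≤ M := by
  rintro ⟨M, hM⟩
  obtain ⟨r, hr0, -, p, hp, c, hc, hle⟩ := hQ
  have hlim : Tendsto (fun i => c * ‖p i‖ ^ s) atTop atTop :=
    ((tendsto_rpow_atTop hs).comp hp).const_mul_atTop hc
  obtain ⟨i, hi, hpi⟩ := ((hlim.eventually_gt_atTop M).and (hp.eventually_gt_atTop 0)).exists
  exact hi.not_ge ((hle i (p i) (Metric.mem_ball_self (mul_pos hr0 hpi))).trans (hM (p i)))

variable [NormedSpace ℝ E] [FiniteDimensional ℝ E] [MeasureSpace E] [BorelSpace E]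
  [(volume : Measure E).IsAddHaarMeasure]

lemma exp_mul_setAverage_ball_le {u : E → ℝ} (hu : Continuous u) (a : ℝ) (p : E) {ρ : ℝ}
    (hρ : 0 < ρ) :
    Real.exp (a * ⨍ x in Metric.ball p ρ, u x) ≤ ⨍ x in Metric.ball p ρ, Real.exp (a * u x) := by
  have hint {g : E → ℝ} (hg : Continuous g) : IntegrableOn g (Metric.ball p ρ) :=
    integrableOn_ball_of_locallyIntegrable hg.locallyIntegrable p ρ
  have hau : a * ⨍ x in Metric.ball p ρ, u x = ⨍ x in Metric.ball p ρ, a * u x := by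
    rw [average, average, integral_const_mul]
  rw [hau]
  exact convexOn_exp.map_set_average_le Real.continuous_exp.continuousOn isClosed_univ
    (Metric.measure_ball_pos _ _ hρ).ne' measure_ball_lt_top.ne
    (ae_of_all _ fun _ => Set.mem_univ _) (hint (by fun_prop)) (hint (by fun_prop))

lemma mul_exp_mul_setAverage_le_integral_abs {Q u : E → ℝ} (hu : Continuous u) {a c r s : ℝ}
    (hs : 0 ≤ s) (hc : 0 ≤ c) (hr0 : 0 < r) (hr1 : r < 1)
    (hf : Integrable fun x => Q x * Real.exp (a * u x)) {p : E} (hp : p ≠ 0)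
    (hQ : ∀ x ∈ Metric.ball p (r * ‖p‖), c * ‖x‖ ^ s ≤ |Q x|) :
    c * ((1 - r) * ‖p‖) ^ s * volume.real (Metric.ball p (r * ‖p‖)) *
        Real.exp (a * ⨍ x in Metric.ball p (r * ‖p‖), u x) ≤
      ∫ x, |Q x * Real.exp (a * u x)| := by
  have hρ : 0 < r * ‖p‖ := mul_pos hr0 (norm_pos_iff.2 hp)
  set B := Metric.ball p (r * ‖p‖)
  have hB : 0 < volume.real B := measureReal_ball_pos _ _ hρ
  have hpoint : ∀ x ∈ B, c * ((1 - r) * ‖p‖) ^ s * Real.exp (a * u x) ≤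
      |Q x * Real.exp (a * u x)| := fun x hx => by
    have hpx : (1 - r) * ‖p‖ ≤ ‖x‖ := by
      have h := norm_sub_norm_le p x
      have hx' := mem_ball_iff_norm'.1 hx
      linarith
    have : 0 ≤ (1 - r) * ‖p‖ := mul_nonneg (by linarith) (norm_nonneg p)
    rw [abs_mul, Real.abs_exp]
    gcongr
    exact le_trans (by gcongr) (hQ x hx)
  have hexp_int : IntegrableOn (fun x => Real.exp (a * u x)) B :=
    integrableOn_ball_of_locallyIntegrable
      (by fun_prop : Continuous fun x => Real.exp (a * u x)).locallyIntegrable _ _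
  have : 0 ≤ c * ((1 - r) * ‖p‖) ^ s := by
    have : 0 ≤ 1 - r := by linarith
    positivity
  calc _ ≤ c * ((1 - r) * ‖p‖) ^ s * volume.real B * ⨍ x in B, Real.exp (a * u x) := by
        gcongr
        exact exp_mul_setAverage_ball_le hu a p hρ
    _ = ∫ x in B, c * ((1 - r) * ‖p‖) ^ s * Real.exp (a * u x) := by
        rw [setAverage_eq, smul_eq_mul, integral_const_mul, mul_assoc,
          mul_inv_cancel_left₀ hB.ne']
    _ ≤ ∫ x in B, |Q x * Real.exp (a * u x)| :=
        setIntegral_mono_on (hexp_int.const_mul _) hf.abs.integrableOn measurableSet_ball hpoint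
    _ ≤ ∫ x, |Q x * Real.exp (a * u x)| :=
        setIntegral_le_integral hf.abs (ae_of_all _ fun _ => abs_nonneg _)

lemma exists_mul_rpow_mul_exp_setAverage_le (hE : 1 ≤ Module.finrank ℝ E) {Q u : E → ℝ}
    (hu : Continuous u) {a c r s : ℝ} (hs : 0 ≤ s) (hc : 0 < c) (hr0 : 0 < r) (hr1 : r < 1)
    (hf : Integrable fun x => Q x * Real.exp (a * u x)) :
    ∃ K : ℝ, 0 < K ∧ ∀ p : E, p ≠ 0 → (∀ x ∈ Metric.ball p (r * ‖p‖), c * ‖x‖ ^ s ≤ |Q x|) →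
      K * ‖p‖ ^ (s + Module.finrank ℝ E) *
          Real.exp (a * ⨍ x in Metric.ball p (r * ‖p‖), u x) ≤
        ∫ x, |Q x * Real.exp (a * u x)| := by
  have : Nontrivial E := Module.nontrivial_of_finrank_pos (R := ℝ) (by lia)
  have h1r : 0 < 1 - r := by linarith
  have hV : 0 < volume.real (Metric.ball (0 : E) 1) := measureReal_ball_pos _ _ one_pos
  refine ⟨c * (1 - r) ^ s * (r ^ Module.finrank ℝ E * volume.real (Metric.ball (0 : E) 1)),
    by positivity, fun p hp hQ => ?_⟩
  have hpos : 0 < ‖p‖ := norm_pos_iff.2 hp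
  have h := mul_exp_mul_setAverage_le_integral_abs hu hs hc.le hr0 hr1 hf hp hQ
  rw [← Measure.addHaar_real_closedBall_eq_addHaar_real_ball,
    Measure.addHaar_real_closedBall _ _ (by positivity), mul_pow,
    Real.mul_rpow h1r.le hpos.le] at h
  rw [Real.rpow_add hpos, Real.rpow_natCast]
  exact le_trans (le_of_eq (by ring)) h

lemma GrowsOnCones.add_finrank_le (hE : 1 ≤ Module.finrank ℝ E) {Q u : E → ℝ} {a s β : ℝ}
    (hQ : GrowsOnCones s Q) (hs : 0 ≤ s) (hu : Continuous u)
    (hf : Integrable fun x => Q x * Real.exp (a * u x))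
    (hmean : ∀ (r : ℝ) (p : ℕ → E), 0 < r → r < 1 → Tendsto (fun i => ‖p i‖) atTop atTop →
      Tendsto (fun i => (⨍ x in Metric.ball (p i) (r * ‖p i‖), u x) / Real.log ‖p i‖)
        atTop (𝓝 (-β))) :
    s + Module.finrank ℝ E ≤ a * β := by
  obtain ⟨r, hr0, hr1, p, hp, c, hc, hcone⟩ := hQ
  obtain ⟨K, hK, hmass⟩ := exists_mul_rpow_mul_exp_setAverage_le hE hu hs hc hr0 hr1 hf
  have hlog : Tendsto (fun i => Real.log ‖p i‖) atTop atTop := Real.tendsto_log_atTop.comp hp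
  set N := ∫ x, |Q x * Real.exp (a * u x)|
  have hle : ∀ᶠ i in atTop, Real.log K / Real.log ‖p i‖ + (s + Module.finrank ℝ E) +
      a * ((⨍ x in Metric.ball (p i) (r * ‖p i‖), u x) / Real.log ‖p i‖) ≤
        Real.log N / Real.log ‖p i‖ := by
    filter_upwards [hp.eventually_gt_atTop 1] with i hi
    have hpi : 0 < ‖p i‖ := by linarith
    have hlogi : 0 < Real.log ‖p i‖ := Real.log_pos hi
    have h := Real.log_le_log (by positivity) (hmass (p i) (norm_pos_iff.1 hpi) (hcone i))
    rw [Real.log_mul (by positivity) (by positivity), Real.log_mul (by positivity) (by positivity),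
      Real.log_exp, Real.log_rpow hpi] at h
    rw [le_div_iff₀ hlogi]
    refine le_trans (le_of_eq ?_) h
    field_simp
  have hlim := le_of_tendsto_of_tendsto
    (((hlog.const_div_atTop _).add_const (s + Module.finrank ℝ E : ℝ)).add
      ((hmean r p hr0 hr1 hp).const_mul a))
    (hlog.const_div_atTop _) hle
  linarith

end ConeGrowth

section DilationDivergence

variable {E : Type*} [NormedAddCommGroup E] [NormedSpace ℝ E]

/-- The divergence of the vector field `x ↦ w x • x`. -/
noncomputable def dilationDiv (w : E → ℝ) (x : E) : ℝ :=
  Module.finrank ℝ E * w x + fderiv ℝ w x x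

variable {w v : E → ℝ}

lemma continuous_fderiv_apply_self (hw : ContDiff ℝ 1 w) : Continuous fun x => fderiv ℝ w x x :=
  (hw.continuous_fderiv one_ne_zero).clm_apply continuous_id

lemma hasCompactSupport_fderiv_apply_self (hc : HasCompactSupport w) :
    HasCompactSupport fun x => fderiv ℝ w x x :=
  (hc.fderiv (𝕜 := ℝ)).mono fun x hx h => hx (by simp [h])

lemma continuous_dilationDiv (hw : ContDiff ℝ 1 w) : Continuous (dilationDiv w) :=
  (continuous_const.mul hw.continuous).add (continuous_fderiv_apply_self hw)

lemma hasCompactSupport_dilationDiv (hc : HasCompactSupport w) :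
    HasCompactSupport (dilationDiv w) :=
  hc.mul_left.add (hasCompactSupport_fderiv_apply_self hc)

lemma dilationDiv_mul (hw : Differentiable ℝ w) (hv : Differentiable ℝ v) (x : E) :
    dilationDiv (fun x => w x * v x) x = dilationDiv w x * v x + w x * fderiv ℝ v x x := by
  simp only [dilationDiv, fderiv_fun_mul (hw x) (hv x), add_apply, smul_apply,
    smul_eq_mul]
  ring

variable [FiniteDimensional ℝ E] [MeasureSpace E] [BorelSpace E]
  [(volume : Measure E).IsAddHaarMeasure]

lemma integral_clm_mul_fderiv_apply (hw : ContDiff ℝ 1 w) (hc : HasCompactSupport w)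
    (ℓ : E →L[ℝ] ℝ) (v : E) : ∫ x, ℓ x * fderiv ℝ w x v = -(ℓ v * ∫ x, w x) := by
  have hw' : Continuous fun x => fderiv ℝ w x v :=
    (hw.continuous_fderiv one_ne_zero).clm_apply continuous_const
  rw [integral_mul_fderiv_eq_neg_fderiv_mul_of_integrable]
  · simp only [ContinuousLinearMap.fderiv, integral_const_mul]
  · simp only [ContinuousLinearMap.fderiv]
    exact (hw.continuous.integrable_of_hasCompactSupport hc).const_mul _
  · exact (ℓ.continuous.mul hw').integrable_of_hasCompactSupport (hc.fderiv_apply ℝ v).mul_left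
  · exact (ℓ.continuous.mul hw.continuous).integrable_of_hasCompactSupport hc.mul_left
  · exact fun x _ => ℓ.differentiableAt
  · exact fun x _ => hw.differentiable one_ne_zero x

lemma integral_fderiv_apply_self (hw : ContDiff ℝ 1 w) (hc : HasCompactSupport w) :
    ∫ x, fderiv ℝ w x x = -(Module.finrank ℝ E * ∫ x, w x) := by
  set b := Module.finBasis ℝ E
  set ℓ : Fin (Module.finrank ℝ E) → E →L[ℝ] ℝ := fun i => (b.coord i).toContinuousLinearMap
  have hsum (x : E) : fderiv ℝ w x x = ∑ i, ℓ i x * fderiv ℝ w x (b i) := by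
    conv_lhs => arg 2; rw [← b.sum_repr x]
    simp only [map_sum, map_smul, smul_eq_mul]
    rfl
  have hint (i) : Integrable fun x => ℓ i x * fderiv ℝ w x (b i) :=
    ((ℓ i).continuous.mul ((hw.continuous_fderiv one_ne_zero).clm_apply
      continuous_const)).integrable_of_hasCompactSupport (hc.fderiv_apply ℝ (b i)).mul_left
  simp only [hsum]
  rw [integral_finsetSum _ fun i _ => hint i]
  simp only [integral_clm_mul_fderiv_apply hw hc]
  simp [ℓ]

lemma integral_dilationDiv (hw : ContDiff ℝ 1 w) (hc : HasCompactSupport w) :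
    ∫ x, dilationDiv w x = 0 := by
  simp only [dilationDiv]
  rw [integral_add ((hw.continuous.integrable_of_hasCompactSupport hc).const_mul _)
    ((continuous_fderiv_apply_self hw).integrable_of_hasCompactSupport
      (hasCompactSupport_fderiv_apply_self hc)), integral_const_mul,
    integral_fderiv_apply_self hw hc, add_neg_cancel]

lemma integral_dilationDiv_mul (hw : ContDiff ℝ 1 w) (hc : HasCompactSupport w)
    (hv : ContDiff ℝ 1 v) :
    ∫ x, dilationDiv w x * v x = -∫ x, w x * fderiv ℝ v x x := by
  have h := integral_dilationDiv (hw.mul hv) hc.mul_right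
  simp only [dilationDiv_mul (hw.differentiable one_ne_zero) (hv.differentiable one_ne_zero)] at h
  rw [integral_add] at h
  · exact eq_neg_of_add_eq_zero_left h
  · exact ((continuous_dilationDiv hw).mul hv.continuous).integrable_of_hasCompactSupport
      (hasCompactSupport_dilationDiv hc).mul_right
  · exact (hw.continuous.mul (continuous_fderiv_apply_self hv)).integrable_of_hasCompactSupport
      hc.mul_right

end DilationDivergence

section SingularIntegrationByParts

lemma tendsto_integral_mul_of_norm_le_locallyIntegrable {X ι : Type*} [TopologicalSpace X]
    [T2Space X] [MeasurableSpace X] [OpensMeasurableSpace X] {μ : Measure X} {l : Filter ι}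
    [l.IsCountablyGenerated] {g K k₀ : X → ℝ} {k : ι → X → ℝ}
    (hg : Continuous g) (hc : HasCompactSupport g) (hK : LocallyIntegrable K μ)
    (hk : ∀ i, AEStronglyMeasurable (k i) μ) (hle : ∀ᶠ i in l, ∀ᵐ x ∂μ, ‖k i x‖ ≤ K x)
    (hlim : ∀ᵐ x ∂μ, Tendsto (fun i => k i x) l (𝓝 (k₀ x))) :
    Tendsto (fun i => ∫ x, g x * k i x ∂μ) l (𝓝 (∫ x, g x * k₀ x ∂μ)) := by
  refine tendsto_integral_filter_of_dominated_convergence (fun x => ‖g x‖ * K x)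
    (Eventually.of_forall fun i => hg.aestronglyMeasurable.mul (hk i)) ?_
    (hK.integrable_smul_left_of_hasCompactSupport hg.norm hc.norm)
    (hlim.mono fun x hx => hx.const_mul (g x))
  filter_upwards [hle] with i hi
  filter_upwards [hi] with x hx
  rw [norm_mul]
  gcongr

lemma abs_log_sq_add_sq_div_two_le {t ε : ℝ} (ht : 0 < t) (hε : |ε| ≤ 1) :
    |Real.log (t ^ 2 + ε ^ 2) / 2| ≤ t + t⁻¹ := by
  have ht_inv : 0 < t⁻¹ := inv_pos.2 ht
  have hε2 : ε ^ 2 ≤ 1 := (sq_le_one_iff_abs_le_one ε).2 hε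
  have upper : Real.log (t ^ 2 + ε ^ 2) ≤ 2 * t :=
    calc Real.log (t ^ 2 + ε ^ 2) ≤ Real.log ((t + 1) ^ 2) :=
          Real.log_le_log (by positivity) (by nlinarith)
      _ = 2 * Real.log (t + 1) := by rw [Real.log_pow]; norm_num
      _ ≤ 2 * t := by linarith [Real.log_le_sub_one_of_pos (show 0 < t + 1 by linarith)]
  have lower : -(2 * t⁻¹) ≤ Real.log (t ^ 2 + ε ^ 2) :=
    calc -(2 * t⁻¹) ≤ 2 * Real.log t := by
          have h := Real.log_le_self ht_inv.le
          rw [Real.log_inv] at h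
          linarith
      _ = Real.log (t ^ 2) := by rw [Real.log_pow]; norm_num
      _ ≤ Real.log (t ^ 2 + ε ^ 2) := Real.log_le_log (by positivity) (by nlinarith)
  rw [abs_le]
  constructor <;> linarith

lemma norm_inner_div_norm_sq_add_sq_le {E : Type*} [NormedAddCommGroup E] [InnerProductSpace ℝ E]
    (z x : E) (ε : ℝ) : ‖inner ℝ z x / (‖z‖ ^ 2 + ε ^ 2)‖ ≤ ‖x‖ * ‖z‖⁻¹ := by
  rcases eq_or_ne z 0 with rfl | hz
  · simp
  have hz0 : 0 < ‖z‖ := norm_pos_iff.2 hz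
  rw [norm_div, Real.norm_of_nonneg (by positivity : 0 ≤ ‖z‖ ^ 2 + ε ^ 2), ← div_eq_mul_inv,
    div_le_div_iff₀ (by positivity) hz0]
  calc ‖inner ℝ z x‖ * ‖z‖ ≤ ‖z‖ * ‖x‖ * ‖z‖ := by gcongr; exact norm_inner_le_norm z x
    _ ≤ ‖x‖ * (‖z‖ ^ 2 + ε ^ 2) := by nlinarith [mul_nonneg (norm_nonneg x) (sq_nonneg ε)]

lemma norm_inner_div_norm_sq_le {E : Type*} [NormedAddCommGroup E] [InnerProductSpace ℝ E]
    (z x : E) : ‖inner ℝ z x / ‖z‖ ^ 2‖ ≤ ‖x‖ * ‖z‖⁻¹ := by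
  simpa using norm_inner_div_norm_sq_add_sq_le z x 0

lemma contDiff_log_norm_sub_sq_add_sq {E : Type*} [NormedAddCommGroup E] [InnerProductSpace ℝ E]
    (y : E) {ε : ℝ} (hε : ε ≠ 0) :
    ContDiff ℝ 1 fun x => Real.log (‖x - y‖ ^ 2 + ε ^ 2) / 2 :=
  ((((contDiff_id.sub contDiff_const).norm_sq ℝ).add contDiff_const).log
    fun x => by positivity).div_const 2

lemma fderiv_log_norm_sub_sq_add_sq_apply_self {E : Type*} [NormedAddCommGroup E]
    [InnerProductSpace ℝ E] (y : E) {ε : ℝ} (hε : ε ≠ 0) (x : E) :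
    fderiv ℝ (fun x => Real.log (‖x - y‖ ^ 2 + ε ^ 2) / 2) x x =
      inner ℝ (x - y) x / (‖x - y‖ ^ 2 + ε ^ 2) := by
  have h := ((((hasFDerivAt_id x).sub_const y).norm_sq).add_const (ε ^ 2)).log
    (by positivity : ‖id x - y‖ ^ 2 + ε ^ 2 ≠ 0)
  have h' := (h.mul_const 2⁻¹).fderiv
  simp only [id, ← div_eq_mul_inv] at h'
  rw [h']
  simp only [map_sub, ContinuousLinearMap.comp_id, smul_apply, sub_apply, coe_innerSL_apply,
    inner_self_eq_norm_sq_to_K, Real.ringHom_apply, nsmul_eq_mul, Nat.cast_ofNat, smul_eq_mul,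
    inner_sub_left]
  ring

variable {E : Type*} [NormedAddCommGroup E] [InnerProductSpace ℝ E] [FiniteDimensional ℝ E]
  [MeasurableSpace E] [BorelSpace E]

lemma integral_dilationDiv_mul_sub_log_norm_sub_sq_add_sq {w : E → ℝ} (hw : ContDiff ℝ 1 w)
    (hc : HasCompactSupport w) (c : ℝ) (y : E) {ε : ℝ} (hε : ε ≠ 0) :
    ∫ x, dilationDiv w x * (c - Real.log (‖x - y‖ ^ 2 + ε ^ 2) / 2) =
      ∫ x, w x * (inner ℝ (x - y) x / (‖x - y‖ ^ 2 + ε ^ 2)) := by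
  rw [integral_dilationDiv_mul hw hc
    (contDiff_const.sub (contDiff_log_norm_sub_sq_add_sq y hε)), ← integral_neg]
  simp only [fderiv_const_sub, neg_apply, fderiv_log_norm_sub_sq_add_sq_apply_self y hε, mul_neg,
    neg_neg]

lemma tendsto_norm_sq_add_sq {F : Type*} [NormedAddCommGroup F] (z : F) :
    Tendsto (fun ε : ℝ => ‖z‖ ^ 2 + ε ^ 2) (𝓝[≠] 0) (𝓝 (‖z‖ ^ 2)) :=
  ((by fun_prop : Continuous fun ε : ℝ => ‖z‖ ^ 2 + ε ^ 2).tendsto' 0 _ (by simp)).mono_left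
    nhdsWithin_le_nhds

lemma tendsto_integral_mul_sub_log_norm_sub_sq_add_sq (hE : 2 ≤ Module.finrank ℝ E) {g : E → ℝ}
    (hg : Continuous g) (hc : HasCompactSupport g) (c : ℝ) (y : E) :
    Tendsto (fun ε : ℝ => ∫ x, g x * (c - Real.log (‖x - y‖ ^ 2 + ε ^ 2) / 2)) (𝓝[≠] 0)
      (𝓝 (∫ x, g x * (c - Real.log ‖x - y‖))) := by
  have : Nontrivial E := Module.nontrivial_of_finrank_pos (R := ℝ) (by lia)
  have hne : ∀ᵐ x : E, x ≠ y := Measure.ae_ne volume y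
  refine tendsto_integral_mul_of_norm_le_locallyIntegrable hg hc
    (K := fun x => |c| + ‖x - y‖ + ‖x - y‖⁻¹)
    ((by fun_prop : Continuous fun x => |c| + ‖x - y‖).locallyIntegrable.add
      (locallyIntegrable_inv_norm_sub hE y))
    (fun ε => (by fun_prop : Measurable _).aestronglyMeasurable) ?_ ?_
  · have hsmall : ∀ᶠ ε : ℝ in 𝓝[≠] 0, |ε| ≤ 1 :=
      nhdsWithin_le_nhds (continuous_abs.tendsto' 0 0 abs_zero |>.eventually_le_const one_pos)
    filter_upwards [hsmall] with ε hε
    filter_upwards [hne] with x hx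
    rw [add_assoc]
    exact (norm_sub_le _ _).trans (add_le_add_right
      (abs_log_sq_add_sq_div_two_le (norm_pos_iff.2 (sub_ne_zero.2 hx)) hε) _)
  · filter_upwards [hne] with x hx
    have h := ((tendsto_norm_sq_add_sq (x - y)).log
      (pow_ne_zero 2 (norm_ne_zero_iff.2 (sub_ne_zero.2 hx)))).div_const 2
    rw [Real.log_pow, Nat.cast_ofNat, mul_div_cancel_left₀ _ two_ne_zero] at h
    exact h.const_sub c

lemma tendsto_integral_mul_inner_div_norm_sub_sq_add_sq (hE : 2 ≤ Module.finrank ℝ E) {g : E → ℝ}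
    (hg : Continuous g) (hc : HasCompactSupport g) (y : E) :
    Tendsto (fun ε : ℝ => ∫ x, g x * (inner ℝ (x - y) x / (‖x - y‖ ^ 2 + ε ^ 2)))
      (𝓝[≠] 0) (𝓝 (∫ x, g x * (inner ℝ (x - y) x / ‖x - y‖ ^ 2))) := by
  have : Nontrivial E := Module.nontrivial_of_finrank_pos (R := ℝ) (by lia)
  refine tendsto_integral_mul_of_norm_le_locallyIntegrable hg hc
    ((locallyIntegrable_inv_norm_sub hE y).continuous_mul continuous_norm)
    (fun ε => (by fun_prop : Measurable _).aestronglyMeasurable)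
    (Eventually.of_forall fun ε => ae_of_all _ fun x =>
      norm_inner_div_norm_sq_add_sq_le _ _ _) ?_
  filter_upwards [Measure.ae_ne volume y] with x hx
  exact tendsto_const_nhds.div (tendsto_norm_sq_add_sq _)
    (pow_ne_zero 2 (norm_ne_zero_iff.2 (sub_ne_zero.2 hx)))

lemma integral_dilationDiv_mul_log_norm_div (hE : 2 ≤ Module.finrank ℝ E) {w : E → ℝ}
    (hw : ContDiff ℝ 1 w) (hc : HasCompactSupport w) {y : E} (hy : y ≠ 0) :
    ∫ x, dilationDiv w x * Real.log (‖y‖ / ‖x - y‖) =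
      ∫ x, w x * (inner ℝ (x - y) x / ‖x - y‖ ^ 2) := by
  have : Nontrivial E := Module.nontrivial_of_finrank_pos (R := ℝ) (by lia)
  have hlog : ∫ x, dilationDiv w x * Real.log (‖y‖ / ‖x - y‖) =
      ∫ x, dilationDiv w x * (Real.log ‖y‖ - Real.log ‖x - y‖) := by
    refine integral_congr_ae ?_
    filter_upwards [Measure.ae_ne volume y] with x hx
    rw [Real.log_div (norm_ne_zero_iff.2 hy) (norm_ne_zero_iff.2 (sub_ne_zero.2 hx))]
  rw [hlog]
  refine tendsto_nhds_unique
    ((tendsto_integral_mul_sub_log_norm_sub_sq_add_sq hE (continuous_dilationDiv hw)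
      (hasCompactSupport_dilationDiv hc) (Real.log ‖y‖) y).congr' ?_)
    (tendsto_integral_mul_inner_div_norm_sub_sq_add_sq hE hw.continuous hc y)
  filter_upwards [self_mem_nhdsWithin] with ε hε
  exact integral_dilationDiv_mul_sub_log_norm_sub_sq_add_sq hw hc (Real.log ‖y‖) y hε

end SingularIntegrationByParts

section PohozaevIdentity

lemma integrable_comp_fst_mul_of_hasCompactSupport {X Y : Type*} [TopologicalSpace X]
    [MeasureSpace X] [OpensMeasurableSpace X] [MeasureSpace Y]
    {g : X → ℝ} (hg : Continuous g) (hc : HasCompactSupport g) {k : X × Y → ℝ}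
    (hk : IntegrableOn k (tsupport g ×ˢ Set.univ)) :
    Integrable fun q : X × Y => g q.1 * k q := by
  obtain ⟨M, hM⟩ := hg.bounded_above_of_compact_support hc
  have hsupp : Function.support (fun q : X × Y => g q.1 * k q) ⊆ tsupport g ×ˢ Set.univ :=
    fun q hq => ⟨subset_tsupport g (left_ne_zero_of_mul hq), Set.mem_univ _⟩
  rw [← integrableOn_iff_integrable_of_support_subset hsupp]
  exact hk.bdd_mul (hg.measurable.comp measurable_fst).aestronglyMeasurable
    (ae_of_all _ fun q => hM q.1)

variable {E : Type*} [NormedAddCommGroup E] [InnerProductSpace ℝ E] [FiniteDimensional ℝ E]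
  [MeasurableSpace E] [BorelSpace E] {f : E → ℝ}

lemma integrableOn_prod_inner_div_mul (hE : 2 ≤ Module.finrank ℝ E) (hf : Integrable f)
    {s : Set E} (hs : Bornology.IsBounded s) :
    IntegrableOn (fun q : E × E => inner ℝ (q.1 - q.2) q.1 / ‖q.1 - q.2‖ ^ 2 * f q.2)
      (s ×ˢ Set.univ) := by
  obtain ⟨P, hsP⟩ := hs.subset_closedBall 0
  have hbound := (integrableOn_prod_inv_norm_sub_mul hE hf
    (s := Metric.closedBall 0 P) measure_closedBall_lt_top.ne).norm.const_mul P
  refine IntegrableOn.mono_set ?_ (Set.prod_mono hsP le_rfl)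
  refine hbound.mono' ((by fun_prop : Measurable fun q : E × E =>
    inner ℝ (q.1 - q.2) q.1 / ‖q.1 - q.2‖ ^ 2).aestronglyMeasurable.mul
      hf.aestronglyMeasurable.comp_snd).restrict
    (ae_restrict_of_forall_mem (measurableSet_closedBall.prod .univ) fun q hq => ?_)
  have hqP : ‖q.1‖ ≤ P := mem_closedBall_zero_iff.1 hq.1
  rw [norm_mul, norm_mul, norm_inv, norm_norm, ← mul_assoc]
  gcongr
  exact (norm_inner_div_norm_sq_le _ _).trans (by gcongr)

lemma integral_dilationDiv_mul_logPotential (hE : 2 ≤ Module.finrank ℝ E) (hf : Integrable f)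
    (hf' : Integrable fun y => f y * ‖y‖⁻¹) {w : E → ℝ} (hw : ContDiff ℝ 1 w)
    (hc : HasCompactSupport w) :
    ∫ x, dilationDiv w x * logPotential f x =
      ∫ q : E × E, w q.1 * (inner ℝ (q.1 - q.2) q.1 / ‖q.1 - q.2‖ ^ 2 * f q.2) := by
  have : Nontrivial E := Module.nontrivial_of_finrank_pos (R := ℝ) (by lia)
  have hlog := integrable_comp_fst_mul_of_hasCompactSupport (continuous_dilationDiv hw)
    (hasCompactSupport_dilationDiv hc) (integrableOn_prod_log_norm_div_mul hE hf hf'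
      (hasCompactSupport_dilationDiv hc).isCompact.isBounded)
  have hinner := integrable_comp_fst_mul_of_hasCompactSupport hw.continuous hc
    (integrableOn_prod_inner_div_mul hE hf hc.isCompact.isBounded)
  calc ∫ x, dilationDiv w x * logPotential f x
      = ∫ x, ∫ y, dilationDiv w x * (Real.log (‖y‖ / ‖x - y‖) * f y) := by
        simp only [logPotential, integral_const_mul]
    _ = ∫ y, (∫ x, dilationDiv w x * Real.log (‖y‖ / ‖x - y‖)) * f y := by
        rw [integral_integral_swap hlog]
        simp only [← integral_mul_const, mul_assoc]
    _ = ∫ y, (∫ x, w x * (inner ℝ (x - y) x / ‖x - y‖ ^ 2)) * f y := by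
        refine integral_congr_ae ?_
        filter_upwards [Measure.ae_ne volume 0] with y hy
        rw [integral_dilationDiv_mul_log_norm_div hE hw hc hy]
    _ = _ := by
        rw [Measure.volume_eq_prod, integral_prod_symm _ hinner]
        simp only [← integral_mul_const, mul_assoc]

lemma integral_mul_fderiv_apply_self_of_eq_logPotential (hE : 2 ≤ Module.finrank ℝ E)
    (hf : Integrable f) (hf' : Integrable fun y => f y * ‖y‖⁻¹) {w u : E → ℝ}
    (hw : ContDiff ℝ 1 w) (hc : HasCompactSupport w) (hu : ContDiff ℝ 1 u) {b C : ℝ}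
    (huf : ∀ x, u x = b * logPotential f x + C) :
    ∫ x, w x * fderiv ℝ u x x =
      -(b * ∫ q : E × E, w q.1 * (inner ℝ (q.1 - q.2) q.1 / ‖q.1 - q.2‖ ^ 2 * f q.2)) := by
  calc ∫ x, w x * fderiv ℝ u x x = ∫ x, w x * fderiv ℝ (fun x => u x - C) x x := by
        simp only [fderiv_sub_const]
    _ = -∫ x, dilationDiv w x * (u x - C) := by
        rw [integral_dilationDiv_mul hw hc (hu.sub contDiff_const), neg_neg]
    _ = _ := by
        simp only [huf, add_sub_cancel_right, mul_left_comm _ b, integral_const_mul,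
          integral_dilationDiv_mul_logPotential hE hf hf' hw hc]

/-- The difference quotient of the vector field `X` at `x` and `y`, in the direction `x - y`. -/
noncomputable def innerDiffQuotient (X : E → E) (q : E × E) : ℝ :=
  inner ℝ (q.1 - q.2) (X q.1 - X q.2) / ‖q.1 - q.2‖ ^ 2

lemma two_mul_integral_mul_inner_div_mul (hE : 2 ≤ Module.finrank ℝ E) (hf : Integrable f)
    (hfc : Continuous f) {η : E → ℝ} (hη : Continuous η) (hc : HasCompactSupport η) :
    2 * ∫ q : E × E, η q.1 * f q.1 * (inner ℝ (q.1 - q.2) q.1 / ‖q.1 - q.2‖ ^ 2 * f q.2) =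
      ∫ q : E × E, innerDiffQuotient (fun x => η x • x) q * (f q.1 * f q.2) := by
  set h : E × E → ℝ := fun q =>
    η q.1 * f q.1 * (inner ℝ (q.1 - q.2) q.1 / ‖q.1 - q.2‖ ^ 2 * f q.2) with h_def
  have hh : Integrable h := integrable_comp_fst_mul_of_hasCompactSupport (hη.mul hfc)
    hc.mul_right (integrableOn_prod_inner_div_mul hE hf hc.mul_right.isCompact.isBounded)
  have hswap : ∫ q : E × E, h q.swap = ∫ q, h q := integral_prod_swap (μ := volume) (ν := volume) h
  calc 2 * ∫ q, h q = (∫ q, h q) + ∫ q : E × E, h q.swap := by rw [hswap, two_mul]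
    _ = ∫ q : E × E, (h q + h q.swap) := (integral_add hh hh.swap).symm
    _ = _ := by
        refine integral_congr_ae (ae_of_all _ fun q => ?_)
        simp only [h_def, innerDiffQuotient, Prod.fst_swap, Prod.snd_swap, inner_sub_right,
          inner_smul_right, norm_sub_rev q.2 q.1]
        rw [← neg_sub q.1 q.2, inner_neg_left]
        ring

lemma integral_cutoff_mul_fderiv_apply_self (hE : 2 ≤ Module.finrank ℝ E) (hf : Integrable f)
    (hfc : ContDiff ℝ 1 f) {η u : E → ℝ} (hη : ContDiff ℝ 1 η) (hc : HasCompactSupport η)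
    (hu : ContDiff ℝ 1 u) {b C : ℝ} (huf : ∀ x, u x = b * logPotential f x + C) :
    ∫ x, η x * f x * fderiv ℝ u x x =
      -(b / 2 * ∫ q : E × E, innerDiffQuotient (fun x => η x • x) q * (f q.1 * f q.2)) := by
  rw [integral_mul_fderiv_apply_self_of_eq_logPotential hE hf
      (integrable_mul_inv_norm hE hfc.continuous hf) (hη.mul hfc) hc.mul_right hu huf,
    ← two_mul_integral_mul_inner_div_mul hE hf hfc.continuous hη.continuous hc]
  ring

end PohozaevIdentity

section CutoffLimits

lemma ae_prod_fst_ne_snd (X : Type*) [TopologicalSpace X] [T2Space X]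
    [SecondCountableTopology X] [MeasureSpace X] [OpensMeasurableSpace X]
    [SFinite (volume : Measure X)] [NullSingletonClass (volume : Measure X)] :
    ∀ᵐ q : X × X, q.1 ≠ q.2 := by
  have hs : MeasurableSet {q : X × X | q.1 ≠ q.2} :=
    (isOpen_ne_fun continuous_fst continuous_snd).measurableSet
  refine (Measure.ae_prod_mem_iff_ae_ae_mem hs).2 (ae_of_all _ fun x => ?_)
  filter_upwards [Measure.ae_ne volume x] with y hy using hy.symm

lemma tendsto_integral_comp_smul_mul {E : Type*} [NormedAddCommGroup E] [NormedSpace ℝ E]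
    [MeasurableSpace E] [BorelSpace E] {μ : Measure E} {f g : E → ℝ}
    (hf : Integrable f μ) (hg : Continuous g) {M : ℝ} (hM : ∀ x, ‖g x‖ ≤ M) :
    Tendsto (fun t : ℝ => ∫ x, g (t • x) * f x ∂μ) (𝓝 0) (𝓝 (g 0 * ∫ x, f x ∂μ)) := by
  rw [← integral_const_mul]
  refine tendsto_integral_filter_of_dominated_convergence (fun x => M * ‖f x‖)
    (Eventually.of_forall fun t =>
      (hg.comp (continuous_const_smul t)).aestronglyMeasurable.mul hf.aestronglyMeasurable)
    (Eventually.of_forall fun t => ae_of_all _ fun x => ?_) (hf.norm.const_mul M)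
    (ae_of_all _ fun x => ?_)
  · rw [norm_mul]
    gcongr
    exact hM _
  · have h : Tendsto (fun t : ℝ => g (t • x)) (𝓝 0) (𝓝 (g 0)) :=
      (by fun_prop : Continuous fun t : ℝ => g (t • x)).tendsto' 0 _ (by simp)
    exact h.mul_const _

lemma eq_zero_of_tendsto_integral_comp_smul_mul {E : Type*} [NormedAddCommGroup E]
    [NormedSpace ℝ E] [MeasurableSpace E] [BorelSpace E] {μ : Measure E} [μ.IsOpenPosMeasure]
    [IsFiniteMeasureOnCompacts μ] {η h : E → ℝ} (hη : Continuous η) (hc : HasCompactSupport η)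
    (hη0 : ∀ x, 0 ≤ η x) (hη1 : 0 < η 0) (hh : Continuous h) (hh0 : ∀ x, 0 ≤ h x)
    (hlim : Tendsto (fun t : ℝ => ∫ x, η (t • x) * h x ∂μ) (𝓝[≠] 0) (𝓝 0)) : h = 0 := by
  set k : ℝ → E → ℝ := fun t x => η (t • x) * h x
  have hk (t : ℝ) : Continuous (k t) := by fun_prop
  have hk0 (t : ℝ) (x : E) : 0 ≤ k t x := mul_nonneg (hη0 _) (hh0 x)
  have hlim' : Tendsto (fun t => ∫⁻ x, ENNReal.ofReal (k t x) ∂μ) (𝓝[≠] 0) (𝓝 0) := by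
    have h := ENNReal.tendsto_ofReal hlim
    rw [ENNReal.ofReal_zero] at h
    refine h.congr' ?_
    filter_upwards [self_mem_nhdsWithin] with t ht
    exact ofReal_integral_eq_lintegral_ofReal ((hk t).integrable_of_hasCompactSupport
      (hc.comp_smul ht).mul_right) (ae_of_all _ (hk0 t))
  have hpoint (x : E) : Tendsto (fun t => ENNReal.ofReal (k t x)) (𝓝[≠] 0)
      (𝓝 (ENNReal.ofReal (η 0 * h x))) :=
    ((ENNReal.continuous_ofReal.comp (by fun_prop : Continuous fun t => k t x)).tendsto' 0 _
      (by simp [k])).mono_left nhdsWithin_le_nhds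
  have hfatou : ∫⁻ x, ENNReal.ofReal (η 0 * h x) ∂μ = 0 := by
    refine le_antisymm ?_ zero_le
    calc ∫⁻ x, ENNReal.ofReal (η 0 * h x) ∂μ
        = ∫⁻ x, liminf (fun t => ENNReal.ofReal (k t x)) (𝓝[≠] 0) ∂μ := by
          simp only [(hpoint _).liminf_eq]
      _ ≤ liminf (fun t => ∫⁻ x, ENNReal.ofReal (k t x) ∂μ) (𝓝[≠] 0) :=
          lintegral_liminf_le fun t => (hk t).measurable.ennreal_ofReal
      _ = 0 := hlim'.liminf_eq
  rw [lintegral_eq_zero_iff (by fun_prop)] at hfatou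
  have hae : h =ᵐ[μ] 0 := by
    filter_upwards [hfatou] with x hx
    have hle := ENNReal.ofReal_eq_zero.1 hx
    exact le_antisymm (nonpos_of_mul_nonpos_right hle hη1) (hh0 x)
  exact (hh.ae_eq_iff_eq μ continuous_zero).1 hae

lemma dilationDiv_comp_smul {E : Type*} [NormedAddCommGroup E] [NormedSpace ℝ E] (η : E → ℝ)
    (t : ℝ) (x : E) : dilationDiv (fun x => η (t • x)) x = dilationDiv η (t • x) := by
  simp only [dilationDiv, fderiv_comp_smul, map_smul, smul_apply]

lemma tendsto_integral_comp_smul_mul_fderiv_apply_self {E : Type*} [NormedAddCommGroup E]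
    [NormedSpace ℝ E] [FiniteDimensional ℝ E] [MeasureSpace E] [BorelSpace E]
    [(volume : Measure E).IsAddHaarMeasure] {f η : E → ℝ} (hf : Integrable f)
    (hfc : ContDiff ℝ 1 f) (hη : ContDiff ℝ 1 η) (hc : HasCompactSupport η) :
    Tendsto (fun t : ℝ => ∫ x, η (t • x) * fderiv ℝ f x x) (𝓝[≠] 0)
      (𝓝 (-(Module.finrank ℝ E * η 0 * ∫ x, f x))) := by
  obtain ⟨M, hM⟩ := (continuous_dilationDiv hη).bounded_above_of_compact_support
    (hasCompactSupport_dilationDiv hc)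
  have h := (tendsto_integral_comp_smul_mul hf (continuous_dilationDiv hη) hM).neg
  have h0 : dilationDiv η 0 = Module.finrank ℝ E * η 0 := by simp [dilationDiv]
  rw [h0] at h
  refine (h.mono_left nhdsWithin_le_nhds).congr' ?_
  filter_upwards [self_mem_nhdsWithin] with t ht
  have hparts := integral_dilationDiv_mul (w := fun x => η (t • x))
    (hη.comp (contDiff_const_smul t)) (hc.comp_smul ht) hfc
  simp only [dilationDiv_comp_smul] at hparts
  rw [hparts, neg_neg]

variable {E : Type*} [NormedAddCommGroup E] [InnerProductSpace ℝ E]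

lemma innerDiffQuotient_comp_smul (η : E → ℝ) {t : ℝ} (ht : t ≠ 0) (q : E × E) :
    innerDiffQuotient (fun x => η (t • x) • x) q =
      innerDiffQuotient (fun x => η x • x) (t • q) := by
  simp only [innerDiffQuotient, Prod.smul_fst, Prod.smul_snd, smul_comm _ t, ← smul_sub,
    inner_smul_left, inner_smul_right, norm_smul, mul_pow, Real.norm_eq_abs, sq_abs, conj_trivial]
  rw [← mul_assoc, ← sq, mul_div_mul_left _ _ (pow_ne_zero 2 ht)]

lemma norm_innerDiffQuotient_le {X : E → E} {L : NNReal} (hX : LipschitzWith L X) (q : E × E) :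
    ‖innerDiffQuotient X q‖ ≤ L :=
  (norm_inner_div_norm_sq_le _ _).trans
    (mul_inv_le_of_le_mul₀ (norm_nonneg _) L.2 (hX.norm_sub_le q.1 q.2))

lemma tendsto_innerDiffQuotient_comp_smul {η : E → ℝ} (hη : Continuous η) {q : E × E}
    (hq : q.1 ≠ q.2) :
    Tendsto (fun t : ℝ => innerDiffQuotient (fun x => η (t • x) • x) q) (𝓝 0) (𝓝 (η 0)) := by
  have hq' : ‖q.1 - q.2‖ ≠ 0 := norm_ne_zero_iff.2 (sub_ne_zero.2 hq)
  refine (by unfold innerDiffQuotient; fun_prop : Continuous fun t : ℝ =>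
    innerDiffQuotient (fun x => η (t • x) • x) q).tendsto' 0 _ ?_
  simp only [innerDiffQuotient, zero_smul, ← smul_sub, inner_smul_right,
    real_inner_self_eq_norm_sq]
  field_simp

variable [FiniteDimensional ℝ E] [MeasurableSpace E] [BorelSpace E]

lemma tendsto_integral_innerDiffQuotient_mul [Nontrivial E] {f η : E → ℝ} (hf : Integrable f)
    (hη : ContDiff ℝ 1 η) (hc : HasCompactSupport η) :
    Tendsto (fun t : ℝ => ∫ q : E × E, innerDiffQuotient (fun x => η (t • x) • x) q *
      (f q.1 * f q.2)) (𝓝[≠] 0) (𝓝 (η 0 * (∫ x, f x) ^ 2)) := by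
  obtain ⟨L, hL⟩ := ContDiff.lipschitzWith_of_hasCompactSupport
    (f := fun x => η x • x) hc.smul_right (hη.smul contDiff_id) one_ne_zero
  have hff : Integrable fun q : E × E => f q.1 * f q.2 := hf.mul_prod hf
  have hsq : η 0 * (∫ x, f x) ^ 2 = ∫ q : E × E, η 0 * (f q.1 * f q.2) := by
    rw [integral_const_mul, sq, Measure.volume_eq_prod, integral_prod_mul]
  rw [hsq]
  refine tendsto_integral_filter_of_dominated_convergence (fun q => L * ‖f q.1 * f q.2‖)
    (Eventually.of_forall fun t => ?_) ?_ (hff.norm.const_mul _) ?_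
  · have := hη.continuous.measurable
    have hmeas : Measurable (innerDiffQuotient fun x => η (t • x) • x) := by
      unfold innerDiffQuotient
      fun_prop
    exact hmeas.aestronglyMeasurable.mul hff.aestronglyMeasurable
  · filter_upwards [self_mem_nhdsWithin] with t ht
    refine ae_of_all _ fun q => ?_
    rw [norm_mul, innerDiffQuotient_comp_smul η ht]
    gcongr
    exact norm_innerDiffQuotient_le hL _
  · filter_upwards [ae_prod_fst_ne_snd E] with q hq
    exact ((tendsto_innerDiffQuotient_comp_smul hη.continuous hq).mono_left
      nhdsWithin_le_nhds).mul_const _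

end CutoffLimits

section PohozaevInequality

lemma eq_apply_zero_of_fderiv_apply_self_eq_zero {E : Type*} [NormedAddCommGroup E]
    [NormedSpace ℝ E] {Q : E → ℝ} (hQ : Differentiable ℝ Q) (h : ∀ x, fderiv ℝ Q x x = 0)
    (x : E) : Q x = Q 0 := by
  have hderiv (t : ℝ) : HasDerivAt (fun t : ℝ => Q (t • x)) (fderiv ℝ Q (t • x) x) t := by
    have hray : HasDerivAt (fun t : ℝ => t • x) x t := by
      simpa only [id, one_smul] using (hasDerivAt_id t).smul_const x
    exact (hQ (t • x)).hasFDerivAt.comp_hasDerivAt t hray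
  obtain ⟨t, ht, hslope⟩ := exists_hasDerivAt_eq_slope (fun t : ℝ => Q (t • x))
    (fun t => fderiv ℝ Q (t • x) x) one_pos
    (fun t _ => (hderiv t).continuousAt.continuousWithinAt) (fun t _ => hderiv t)
  have hzero : fderiv ℝ Q (t • x) x = 0 := by
    have h' := h (t • x)
    rw [map_smul, smul_eq_mul] at h'
    exact (mul_eq_zero.1 h').resolve_left ht.1.ne'
  rw [hzero, one_smul, zero_smul, sub_zero, div_one] at hslope
  linarith

lemma fderiv_mul_exp_mul {E : Type*} [NormedAddCommGroup E] [NormedSpace ℝ E] {Q u : E → ℝ}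
    (hQ : Differentiable ℝ Q) (hu : Differentiable ℝ u) (a : ℝ) (x v : E) :
    fderiv ℝ (fun x => Q x * Real.exp (a * u x)) x v =
      fderiv ℝ Q x v * Real.exp (a * u x) + a * (Q x * Real.exp (a * u x) * fderiv ℝ u x v) := by
  have h := ((hQ x).hasFDerivAt.mul ((hu x).hasFDerivAt.const_mul a).exp).fderiv
  refine (DFunLike.congr_fun h v).trans ?_
  simp only [add_apply, smul_apply, smul_eq_mul]
  ring

lemma exists_contDiff_hasCompactSupport_cutoff (E : Type*) [NormedAddCommGroup E]
    [InnerProductSpace ℝ E] [FiniteDimensional ℝ E] :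
    ∃ η : E → ℝ, ContDiff ℝ 1 η ∧ HasCompactSupport η ∧ (∀ x, 0 ≤ η x) ∧ η 0 = 1 := by
  let χ : ContDiffBump (0 : E) := default
  exact ⟨χ, χ.contDiff, χ.hasCompactSupport, fun _ => χ.nonneg,
    χ.one_of_mem_closedBall (Metric.mem_closedBall_self χ.rIn_pos.le)⟩

variable {E : Type*} [NormedAddCommGroup E] [InnerProductSpace ℝ E] [FiniteDimensional ℝ E]
  [MeasurableSpace E] [BorelSpace E] {Q u : E → ℝ} {a b C : ℝ}

lemma tendsto_integral_cutoff_mul_fderiv_apply_self_mul_exp (hE : 2 ≤ Module.finrank ℝ E)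
    (hQ : ContDiff ℝ 1 Q) (hu : ContDiff ℝ 1 u)
    (hf : Integrable fun x => Q x * Real.exp (a * u x))
    (hrep : ∀ x, u x = b * logPotential (fun y => Q y * Real.exp (a * u y)) x + C)
    {η : E → ℝ} (hη : ContDiff ℝ 1 η) (hc : HasCompactSupport η) :
    Tendsto (fun t : ℝ => ∫ x, η (t • x) * (fderiv ℝ Q x x * Real.exp (a * u x))) (𝓝[≠] 0)
      (𝓝 (η 0 * (a * b / 2 * (∫ x, Q x * Real.exp (a * u x)) ^ 2 -
        Module.finrank ℝ E * ∫ x, Q x * Real.exp (a * u x)))) := by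
  have : Nontrivial E := Module.nontrivial_of_finrank_pos (R := ℝ) (by lia)
  set f : E → ℝ := fun x => Q x * Real.exp (a * u x)
  have hfc : ContDiff ℝ 1 f := hQ.mul (contDiff_const.mul hu).exp
  have hlim := (tendsto_integral_comp_smul_mul_fderiv_apply_self hf hfc hη hc).add
    ((tendsto_integral_innerDiffQuotient_mul hf hη hc).const_mul (a * b / 2))
  refine (hlim.congr' ?_).trans_eq (by ring_nf)
  filter_upwards [self_mem_nhdsWithin] with t ht
  have hη' : ContDiff ℝ 1 fun x => η (t • x) := hη.comp (contDiff_const_smul t)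
  have hc' : HasCompactSupport fun x => η (t • x) := hc.comp_smul ht
  have hdf : Integrable fun x => η (t • x) * fderiv ℝ f x x :=
    (hη'.continuous.mul (continuous_fderiv_apply_self hfc)).integrable_of_hasCompactSupport
      hc'.mul_right
  have hdu : Integrable fun x => η (t • x) * f x * fderiv ℝ u x x :=
    ((hη'.continuous.mul hfc.continuous).mul
      (continuous_fderiv_apply_self hu)).integrable_of_hasCompactSupport hc'.mul_right.mul_right
  calc _ = (∫ x, η (t • x) * fderiv ℝ f x x) - a * ∫ x, η (t • x) * f x * fderiv ℝ u x x := by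
        rw [integral_cutoff_mul_fderiv_apply_self hE hf hfc hη' hc' hu hrep]
        ring
    _ = ∫ x, (η (t • x) * fderiv ℝ f x x - a * (η (t • x) * f x * fderiv ℝ u x x)) := by
        rw [integral_sub hdf (hdu.const_mul a), integral_const_mul]
    _ = _ := by
        refine integral_congr_ae (ae_of_all _ fun x => ?_)
        simp only [f, fderiv_mul_exp_mul (hQ.differentiable one_ne_zero)
          (hu.differentiable one_ne_zero)]
        ring

lemma mul_integral_sq_le_of_fderiv_apply_self_nonpos (hE : 2 ≤ Module.finrank ℝ E)
    (hQ : ContDiff ℝ 1 Q) (hu : ContDiff ℝ 1 u)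
    (hf : Integrable fun x => Q x * Real.exp (a * u x))
    (hrep : ∀ x, u x = b * logPotential (fun y => Q y * Real.exp (a * u y)) x + C)
    (hrad : ∀ x, fderiv ℝ Q x x ≤ 0) :
    a * b / 2 * (∫ x, Q x * Real.exp (a * u x)) ^ 2 ≤
      Module.finrank ℝ E * ∫ x, Q x * Real.exp (a * u x) := by
  obtain ⟨η, hη, hc, hη_nonneg, hη_zero⟩ := exists_contDiff_hasCompactSupport_cutoff E
  have hlim := tendsto_integral_cutoff_mul_fderiv_apply_self_mul_exp hE hQ hu hf hrep hη hc
  rw [hη_zero, one_mul] at hlim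
  exact sub_nonpos.1 <| le_of_tendsto hlim <| Eventually.of_forall fun t =>
    integral_nonpos fun x => mul_nonpos_of_nonneg_of_nonpos (hη_nonneg _)
      (mul_nonpos_of_nonpos_of_nonneg (hrad x) (Real.exp_pos _).le)

lemma fderiv_apply_self_eq_zero_of_mul_integral_sq_eq (hE : 2 ≤ Module.finrank ℝ E)
    (hQ : ContDiff ℝ 1 Q) (hu : ContDiff ℝ 1 u)
    (hf : Integrable fun x => Q x * Real.exp (a * u x))
    (hrep : ∀ x, u x = b * logPotential (fun y => Q y * Real.exp (a * u y)) x + C)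
    (hrad : ∀ x, fderiv ℝ Q x x ≤ 0)
    (heq : a * b / 2 * (∫ x, Q x * Real.exp (a * u x)) ^ 2 =
      Module.finrank ℝ E * ∫ x, Q x * Real.exp (a * u x)) (x : E) :
    fderiv ℝ Q x x = 0 := by
  obtain ⟨η, hη, hc, hη_nonneg, hη_zero⟩ := exists_contDiff_hasCompactSupport_cutoff E
  have hlim := (tendsto_integral_cutoff_mul_fderiv_apply_self_mul_exp hE hQ hu hf hrep hη hc).neg
  rw [heq, sub_self, mul_zero, neg_zero] at hlim
  simp only [← integral_neg, ← mul_neg] at hlim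
  have hcont : Continuous fun x => fderiv ℝ Q x x * -Real.exp (a * u x) :=
    (continuous_fderiv_apply_self hQ).mul (hu.continuous.const_mul a).rexp.neg
  have hzero := eq_zero_of_tendsto_integral_comp_smul_mul hη.continuous hc hη_nonneg
    (hη_zero ▸ one_pos) hcont
    (fun x => mul_nonneg_of_nonpos_of_nonpos (hrad x) (neg_nonpos.2 (Real.exp_pos _).le)) hlim
  exact (mul_eq_zero.1 (congrFun hzero x)).resolve_right (neg_ne_zero.2 (Real.exp_pos _).ne')

end PohozaevInequality

theorem mainTheorem8_general {E : Type*} [NormedAddCommGroup E] [InnerProductSpace ℝ E]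
    [FiniteDimensional ℝ E] [MeasurableSpace E] [BorelSpace E] (hE : 2 ≤ Module.finrank ℝ E)
    {a b s : ℝ} (hab : 0 ≤ a * b) (hs : (Module.finrank ℝ E : ℝ) ≤ s) {Q : E → ℝ}
    (hQ : ContDiff ℝ 1 Q) (hcone : GrowsOnCones s Q) (hrad : ∀ x, fderiv ℝ Q x x ≤ 0) :
    ¬ ∃ u : E → ℝ, ContDiff ℝ 1 u ∧ Integrable (fun x => Q x * Real.exp (a * u x)) ∧
      ∃ C : ℝ, ∀ x, u x = b * logPotential (fun y => Q y * Real.exp (a * u y)) x + C := by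
  rintro ⟨u, hu, hf, C, hrep⟩
  set F := ∫ x, Q x * Real.exp (a * u x)
  have hd : (0 : ℝ) < Module.finrank ℝ E := by exact_mod_cast (by lia)
  have hf_inv := integrable_mul_inv_norm hE
    (hQ.continuous.mul (hu.continuous.const_mul a).rexp) hf
  have lower : s + Module.finrank ℝ E ≤ a * (b * F) :=
    hcone.add_finrank_le (by lia) (hd.le.trans hs) hu.continuous hf fun r p hr0 hr1 hp =>
      tendsto_setAverage_div_log_of_eq_logPotential hE hf hf_inv hrep hr0 hr1.le hp
  have upper : a * b / 2 * F ^ 2 ≤ Module.finrank ℝ E * F :=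
    mul_integral_sq_le_of_fderiv_apply_self_nonpos hE hQ hu hf hrep hrad
  have hF : 0 < F := by nlinarith
  have hrigid : a * b / 2 * F ^ 2 = Module.finrank ℝ E * F := by nlinarith
  have hQ_const := eq_apply_zero_of_fderiv_apply_self_eq_zero (hQ.differentiable one_ne_zero)
    (fderiv_apply_self_eq_zero_of_mul_integral_sq_eq hE hQ hu hf hrep hrad hrigid)
  exact hcone.not_bounded (hd.trans_le hs) ⟨|Q 0|, fun x => (congrArg abs (hQ_const x)).le⟩

theorem mainTheorem8 (n : ℕ) (hn : 2 ≤ n) (hne : Even n) (s : ℝ) (hs : (n : ℝ) ≤ s)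
    (Q : EuclideanSpace ℝ (Fin n) → ℝ) (hQ : ContDiff ℝ ∞ Q)
    (hcone : SatisfiesCone s Q)
    (hrad : ∀ x : EuclideanSpace ℝ (Fin n), inner ℝ x (gradient Q x) ≤ 0) :
    ¬ ∃ u : EuclideanSpace ℝ (Fin n) → ℝ, ContDiff ℝ ∞ u ∧
      Integrable (fun x => Q x * Real.exp (n * u x)) volume ∧
      IsNormalSolution n Q u := by
  rintro ⟨u, hu, hf, hrep⟩
  have hdim : Module.finrank ℝ (EuclideanSpace ℝ (Fin n)) = n := finrank_euclideanSpace_fin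
  have hcoeff : 0 ≤ n * (2 / (((n - 1)! : ℕ) * sphereVolume n)) := mul_nonneg n.cast_nonneg
    (div_nonneg zero_le_two (mul_nonneg (Nat.cast_nonneg _) measureReal_nonneg))
  refine mainTheorem8_general (by rwa [hdim]) hcoeff (by rwa [hdim]) (hQ.of_le (mod_cast le_top))
    hcone.growsOnCones (fun x => ?_) ⟨u, hu.of_le (mod_cast le_top), hf, hrep⟩
  rw [← inner_gradient_left, real_inner_comm]
  exact hrad x
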